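/- Let $(X,d)$ be a non-empty proper metric space. A geodesic bicombing on $X$ is a continuous map $\sigma\colon X\times X\times[0,1]\to X$, $(x,y,t)\mapsto\sigma_{xy}(t)$, such that each $\sigma_{xy}$ is a constant speed geodesic from $x$ to $y$. It is called ccc if it is consistent, i.e. $\mathrm{im}\,\sigma_{\sigma_{xy}(s),\sigma_{xy}(t)}=\sigma_{xy}([s,t])$ for all $x,y\in X$ and $0\le s<t\le1$, and conical, i.e. $d(\sigma_{xy}(t),\sigma_{x'y'}(t))\le(1-t)d(x,x')+t\,d(y,y')$ for all $x,y,x',y'\in X$ and $t\in[0,1]$ (these two conditions imply that $t\mapsto d(\sigma_{xy}(t),\sigma_{x'y'}(t))$ is convex). It is reversible if $\sigma_{xy}(t)=\sigma_{yx}(1-t)$, and, for a group $G$ acting on $X$, it is $G$-equivariant if $g\sigma_{xy}=\sigma_{gx,gy}$ for all $g\in G$. A $\sigma$-ray is an isometric embedding $\xi\colon[0,\infty)\to X$ with $\mathrm{im}\,\sigma_{\xi(0)\xi(t)}=\xi([0,t])$ for all $t\ge0$; two $\sigma$-rays $\xi,\zeta$ are asymptotic if $\sup_{t\ge0}d(\xi(t),\zeta(t))<\infty$.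 For a ccc bicombing $\sigma$, the boundary $\partial_\sigma X$ is the set of asymptoty classes of $\sigma$-rays, with the topology generated, for a basepoint $o\in X$, by the sets $\{[\eta] : \eta \text{ a } \sigma\text{-ray},\ \eta(0)=o,\ d(\eta(t),\xi(t))<\varepsilon\}$, where $\xi$ is a $\sigma$-ray with $\xi(0)=o$, $t\ge0$ and $\varepsilon>0$. (The topology does not depend on $o$.) Let $G$ be a group acting geometrically on $X$, that is, by isometries, with $\{g\in G: gK\cap K\ne\emptyset\}$ finite for every compact $K\subseteq X$, and with compact quotient $G\backslash X$. Let $\sigma$ be a ccc, reversible, $G$-equivariant geodesic bicombing on $X$, let $n\ge0$, and let $A\le G$ be a subgroup isomorphic to $\mathbb{Z}^n$. Then $\partial_\sigma X$ contains a homeomorphic copy of the unit sphere $S^{n-1}\subset\mathbb{R}^n$ (with $S^{-1}=\emptyset$). Moreover, if $A$ has finite index in $G$, then $\partial_\sigma X$ is homeomorphic to $S^{n-1}$. -/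

import Mathlib

open scoped NNReal

/-- A geodesic bicombing on a metric space `X`: a continuous choice, for every ordered pair of
points `x, y`, of a constant speed geodesic `[0,1] → X` from `x` to `y`.
(In particular `X` is a geodesic space.) -/
structure GeodesicBicombing (X : Type*) [MetricSpace X] where
  /-- The `σ`-geodesic from `x` to `y`, evaluated at time `t`. -/
  path : X → X → unitInterval → X
  continuous_path : Continuous (fun p : X × X × unitInterval => path p.1 p.2.1 p.2.2)
  path_zero : ∀ x y, path x y 0 = x
  path_one : ∀ x y, path x y 1 = y
  dist_path : ∀ (x y : X) (s t : unitInterval),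
    dist (path x y s) (path x y t) = |(s : ℝ) - (t : ℝ)| * dist x y

namespace GeodesicBicombing

variable {X : Type*} [MetricSpace X]

/-- Every subsegment of a `σ`-geodesic is the image of the `σ`-geodesic between its endpoints. -/
def IsConsistent (σ : GeodesicBicombing X) : Prop :=
  ∀ (x y : X) (s t : unitInterval), s < t →
    Set.range (σ.path (σ.path x y s) (σ.path x y t)) = σ.path x y '' Set.Icc s t

/-- `d(σ_{xy}(t), σ_{x'y'}(t)) ≤ (1 - t) d(x,x') + t d(y,y')`. -/
def IsConical (σ : GeodesicBicombing X) : Prop :=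
  ∀ (x y x' y' : X) (t : unitInterval),
    dist (σ.path x y t) (σ.path x' y' t) ≤ (1 - (t : ℝ)) * dist x x' + (t : ℝ) * dist y y'

/-- A `ccc` bicombing: consistent and conical. Convexity of the functions
`t ↦ d(σ_{xy}(t), σ_{x'y'}(t))` is a consequence of these two conditions. -/
structure IsCCC (σ : GeodesicBicombing X) : Prop where
  consistent : σ.IsConsistent
  conical : σ.IsConical

/-- `σ_{xy}(t) = σ_{yx}(1 - t)`. -/
def IsReversible (σ : GeodesicBicombing X) : Prop :=
  ∀ (x y : X) (t : unitInterval), σ.path x y t = σ.path y x (unitInterval.symm t)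

/-- `g σ_{xy} = σ_{gx,gy}` for every `g ∈ G`. -/
def IsEquivariant (G : Type*) [Group G] [MulAction G X] (σ : GeodesicBicombing X) : Prop :=
  ∀ (g : G) (x y : X) (t : unitInterval), g • σ.path x y t = σ.path (g • x) (g • y) t

/-- A `σ`-ray: an isometric embedding `ξ : [0,∞) → X` such that `ξ([0,t])` is the image of the
`σ`-geodesic from `ξ(0)` to `ξ(t)`, for every `t ≥ 0`. -/
structure Ray (σ : GeodesicBicombing X) where
  /-- The underlying map `[0,∞) → X`. -/
  toFun : ℝ≥0 → X
  isometry : Isometry toFun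
  range_path : ∀ t : ℝ≥0, Set.range (σ.path (toFun 0) (toFun t)) = toFun '' Set.Icc 0 t

/-- Two `σ`-rays `ξ, ζ` are asymptotic if `sup_t d(ξ(t), ζ(t)) < ∞`. -/
def Asymptotic {σ : GeodesicBicombing X} (ξ ζ : σ.Ray) : Prop :=
  ∃ C : ℝ, ∀ t : ℝ≥0, dist (ξ.toFun t) (ζ.toFun t) ≤ C

theorem asymptotic_equivalence (σ : GeodesicBicombing X) :
    Equivalence (Asymptotic : σ.Ray → σ.Ray → Prop) where
  refl ξ := ⟨0, fun t => by simp⟩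
  symm := by
    rintro ξ ζ ⟨C, h⟩
    exact ⟨C, fun t => by rw [dist_comm]; exact h t⟩
  trans := by
    rintro ξ ζ η ⟨C, h⟩ ⟨D, k⟩
    exact ⟨C + D, fun t => (dist_triangle _ (ζ.toFun t) _).trans (add_le_add (h t) (k t))⟩

/-- The equivalence relation "asymptotic" on `σ`-rays. -/
def asymptoticSetoid (σ : GeodesicBicombing X) : Setoid σ.Ray where
  r := Asymptotic
  iseqv := σ.asymptotic_equivalence

/-- The boundary `∂_σ X`: the set of classes of asymptotic `σ`-rays. The basepoint `o` plays no
role for the underlying set; it is only used to define the topology. -/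
def Boundary (σ : GeodesicBicombing X) (_o : X) : Type _ := Quotient σ.asymptoticSetoid

/-- The class in `∂_σ X` of a `σ`-ray. -/
def Ray.toBoundary {σ : GeodesicBicombing X} (ξ : σ.Ray) (o : X) : σ.Boundary o :=
  Quotient.mk σ.asymptoticSetoid ξ

/-- For a `σ`-ray `ξ` with origin `o`, the set of boundary points represented by a `σ`-ray `η`
with origin `o` such that `d(η(t), ξ(t)) < ε`. -/
def basicSet {σ : GeodesicBicombing X} (o : X) (ξ : σ.Ray) (t : ℝ≥0) (ε : ℝ) :
    Set (σ.Boundary o) :=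
  {y | ∃ η : σ.Ray, η.toFun 0 = o ∧ η.toBoundary o = y ∧ dist (η.toFun t) (ξ.toFun t) < ε}

/-- The topology of `∂_σ X`, generated by the sets `basicSet o ξ t ε`, where `ξ` runs over the
`σ`-rays with origin `o`, and `t ≥ 0`, `ε > 0`. -/
instance (σ : GeodesicBicombing X) (o : X) : TopologicalSpace (σ.Boundary o) :=
  TopologicalSpace.generateFrom
    {U | ∃ (ξ : σ.Ray) (t : ℝ≥0) (ε : ℝ), ξ.toFun 0 = o ∧ 0 < ε ∧ U = basicSet o ξ t ε}

end GeodesicBicombing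

/-- A geometric action: by isometries, proper, and cocompact. -/
structure IsGeometricAction (G X : Type*) [Group G] [MetricSpace X] [MulAction G X] : Prop where
  isometry : ∀ g : G, Isometry (fun x : X => g • x)
  proper : ∀ K : Set X, IsCompact K → {g : G | ((fun x => g • x) '' K ∩ K).Nonempty}.Finite
  cocompact : CompactSpace (Quotient (MulAction.orbitRel G X))

/-!
The key estimate is that the `σ`-geodesic from `o` to `a o`, for `a` in a free abelian subgroup
`A ≅ ℤⁿ`, stays within bounded distance of the orbit points `b o` with `b ∈ ℤⁿ` close to `t a`.
Given `a`, `b` and `t`, the map `E x = b⁻¹ σ_{x, ax}(t)` is nonexpansive and one has to bound the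
distance from `o` to `E o`. For small `ε > 0` the map `x ↦ σ_{o, E x}(1 - ε)` is a contraction;
let `x` be its fixed point, so that `d(x, E x) = ε d(o, E x)`. By conicality `u(w) = d(w o, x)` is
dominated by an `ε`-discounted average of its values at `w + b` and `w + b - a`. Since these steps
have bounded mean `b - t a`, comparison with a quadratic function of `w` bounds `ε u(0)`, hence
`d(x, E x)`, independently of `a` as `ε → 0`. Generators of `A` displace `x` by a bounded amount, so
`x` is close to `c o` for some `c` centralizing `A`. As `c` commutes with `E`, the point `o` is
almost fixed along with `x`.

The orbit is therefore a coarse cone over `ℝⁿ`. Contracting it along `σ`-geodesics towards `o` and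
passing to the limit yields a continuous map `R : ℝⁿ → X` at bounded distance from the orbit that
takes radial segments to `σ`-geodesics. Directions in `Sⁿ⁻¹` then give the rays of the embedded
sphere; if `A` has finite index, `R` is coarsely onto, and every ray is asymptotic to one of these.
-/

theorem le_of_forall_le_add_div {x y c : ℝ} (h : ∀ T : ℝ, 1 ≤ T → x ≤ y + c / T) : x ≤ y := by
  have hlim : Filter.Tendsto (fun T : ℝ => y + c / T) Filter.atTop (nhds (y + 0)) :=
    tendsto_const_nhds.add (tendsto_const_nhds.div_atTop Filter.tendsto_id)
  rw [add_zero] at hlim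
  exact ge_of_tendsto hlim ((Filter.eventually_ge_atTop 1).mono h)

theorem inv_mem_Icc_of_one_le {T : ℝ} (hT : 1 ≤ T) : T⁻¹ ∈ Set.Icc (0 : ℝ) 1 :=
  ⟨inv_nonneg.2 (zero_le_one.trans hT), inv_le_one_of_one_le₀ hT⟩

/-- A map between metric spaces is uniformly proper if points with nearby images are themselves
at bounded distance, the bound depending only on the distance of the images. Unlike for a coarse
embedding, no upper control on the distance of the images is required. -/
def IsUniformlyProper {V X : Type*} [PseudoMetricSpace V] [PseudoMetricSpace X] (f : V → X) :
    Prop :=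
  ∀ r : ℝ, ∃ s : ℝ, ∀ v w, dist (f v) (f w) ≤ r → dist v w ≤ s

theorem IsUniformlyProper.of_dist_le {V X : Type*} [PseudoMetricSpace V] [PseudoMetricSpace X]
    {f g : V → X} (hf : IsUniformlyProper f) {C : ℝ} (hfg : ∀ v, dist (f v) (g v) ≤ C) :
    IsUniformlyProper g := by
  intro r
  obtain ⟨s, hs⟩ := hf (C + r + C)
  refine ⟨s, fun v w hvw => hs v w ?_⟩
  calc dist (f v) (f w) ≤ dist (f v) (g v) + dist (g v) (g w) + dist (g w) (f w) :=
        dist_triangle4 _ _ _ _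
    _ ≤ C + r + C := add_le_add_three (hfg v) hvw (dist_comm (f w) (g w) ▸ hfg w)

namespace GeodesicBicombing

variable {X : Type*} [MetricSpace X]

/-! ### Geodesics with real parameter -/

section Geod

/-- The `σ`-geodesic from `x` to `y` as a function on `ℝ`; the parameter is projected to `[0,1]`,
so that the function is constant on either side of this interval. -/
noncomputable def geod (σ : GeodesicBicombing X) (x y : X) (t : ℝ) : X :=
  σ.path x y (Set.projIcc 0 1 zero_le_one t)

theorem geod_of_mem (σ : GeodesicBicombing X) (x y : X) {t : ℝ} (ht : t ∈ Set.Icc (0 : ℝ) 1) :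
    σ.geod x y t = σ.path x y ⟨t, ht⟩ := by
  rw [geod, Set.projIcc_of_mem zero_le_one ht]

theorem geod_coe (σ : GeodesicBicombing X) (x y : X) (t : unitInterval) :
    σ.geod x y t = σ.path x y t :=
  σ.geod_of_mem x y t.2

@[simp]
theorem geod_zero (σ : GeodesicBicombing X) (x y : X) : σ.geod x y 0 = x :=
  (σ.geod_coe x y 0).trans (σ.path_zero x y)

@[simp]
theorem geod_one (σ : GeodesicBicombing X) (x y : X) : σ.geod x y 1 = y :=
  (σ.geod_coe x y 1).trans (σ.path_one x y)

theorem dist_geod (σ : GeodesicBicombing X) (x y : X) {s t : ℝ} (hs : s ∈ Set.Icc (0 : ℝ) 1)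
    (ht : t ∈ Set.Icc (0 : ℝ) 1) :
    dist (σ.geod x y s) (σ.geod x y t) = |s - t| * dist x y := by
  rw [σ.geod_of_mem x y hs, σ.geod_of_mem x y ht, σ.dist_path]

theorem dist_geod_left (σ : GeodesicBicombing X) (x y : X) {t : ℝ}
    (ht : t ∈ Set.Icc (0 : ℝ) 1) : dist x (σ.geod x y t) = t * dist x y := by
  simpa [abs_of_nonneg ht.1] using σ.dist_geod x y (Set.left_mem_Icc.2 zero_le_one) ht

theorem dist_geod_right (σ : GeodesicBicombing X) (x y : X) {t : ℝ}
    (ht : t ∈ Set.Icc (0 : ℝ) 1) : dist (σ.geod x y t) y = (1 - t) * dist x y := by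
  simpa [abs_sub_comm t, abs_of_nonneg (sub_nonneg.2 ht.2)] using
    σ.dist_geod x y ht (Set.right_mem_Icc.2 zero_le_one)

@[simp]
theorem geod_self (σ : GeodesicBicombing X) (x : X) (t : ℝ) : σ.geod x x t = x := by
  have h := σ.dist_geod_left x x (Set.projIcc (0 : ℝ) 1 zero_le_one t).2
  rw [dist_self, mul_zero, geod_coe] at h
  exact (dist_eq_zero.1 h).symm

variable {σ : GeodesicBicombing X}

theorem IsConical.dist_geod_le (hc : σ.IsConical) (x y x' y' : X) {t : ℝ}
    (ht : t ∈ Set.Icc (0 : ℝ) 1) :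
    dist (σ.geod x y t) (σ.geod x' y' t) ≤ (1 - t) * dist x x' + t * dist y y' := by
  rw [σ.geod_of_mem x y ht, σ.geod_of_mem x' y' ht]
  exact hc x y x' y' ⟨t, ht⟩

theorem IsConical.dist_geod_le_of_left (hc : σ.IsConical) (x y y' : X) {t : ℝ}
    (ht : t ∈ Set.Icc (0 : ℝ) 1) :
    dist (σ.geod x y t) (σ.geod x y' t) ≤ t * dist y y' := by
  simpa using hc.dist_geod_le x y x y' ht

theorem IsConical.dist_point_geod_le (hc : σ.IsConical) (z x y : X) {t : ℝ}
    (ht : t ∈ Set.Icc (0 : ℝ) 1) :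
    dist z (σ.geod x y t) ≤ (1 - t) * dist z x + t * dist z y := by
  simpa using hc.dist_geod_le z z x y ht

theorem IsConsistent.geod_geod (h : σ.IsConsistent) (x y : X) {t u : ℝ}
    (ht : t ∈ Set.Icc (0 : ℝ) 1) (hu : u ∈ Set.Icc (0 : ℝ) 1) :
    σ.geod x (σ.geod x y t) u = σ.geod x y (u * t) := by
  rcases ht.1.eq_or_lt with rfl | ht0
  · simp
  have hmem : σ.geod x (σ.geod x y t) u ∈ σ.path x y '' Set.Icc 0 ⟨t, ht⟩ := by
    rw [← h x y 0 ⟨t, ht⟩ (Subtype.mk_lt_mk.2 ht0), σ.path_zero, ← σ.geod_of_mem x y ht,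
      σ.geod_of_mem _ _ hu]
    exact Set.mem_range_self _
  obtain ⟨s, -, hs⟩ := hmem
  rw [← geod_coe] at hs
  have hdist : s * dist x y = u * t * dist x y := by
    rw [← σ.dist_geod_left x y s.2, hs, σ.dist_geod_left _ _ hu, σ.dist_geod_left x y ht, mul_assoc]
  rcases eq_or_ne x y with rfl | hxy
  · simp
  · rw [← hs, mul_right_cancel₀ (dist_ne_zero.2 hxy) hdist]

end Geod

/-! ### Rays and the boundary -/

section Ray

variable {σ : GeodesicBicombing X}

theorem Ray.geod_eq (ξ : σ.Ray) (t : ℝ≥0) {u : ℝ≥0} (hu : u ≤ 1) :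
    σ.geod (ξ.toFun 0) (ξ.toFun t) u = ξ.toFun (u * t) := by
  have hu' : (u : ℝ) ∈ Set.Icc (0 : ℝ) 1 := ⟨u.2, mod_cast hu⟩
  have hmem : σ.geod (ξ.toFun 0) (ξ.toFun t) u ∈ ξ.toFun '' Set.Icc 0 t := by
    rw [← ξ.range_path, σ.geod_of_mem _ _ hu']
    exact Set.mem_range_self _
  obtain ⟨s, -, hs⟩ := hmem
  have hdist := σ.dist_geod_left (ξ.toFun 0) (ξ.toFun t) hu'
  rw [← hs, ξ.isometry.dist_eq, ξ.isometry.dist_eq, NNReal.dist_eq, NNReal.dist_eq] at hdist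
  simp only [NNReal.coe_zero, zero_sub, abs_neg, NNReal.abs_eq] at hdist
  rw [← hs, show s = u * t from mod_cast hdist]

theorem range_path_eq_image_Icc {γ : ℝ≥0 → X} {t : ℝ≥0}
    (h : ∀ u : ℝ≥0, u ≤ 1 → σ.geod (γ 0) (γ t) u = γ (u * t)) :
    Set.range (σ.path (γ 0) (γ t)) = γ '' Set.Icc 0 t := by
  apply Set.Subset.antisymm
  · rintro _ ⟨u, rfl⟩
    have hu : unitInterval.toNNReal u ≤ 1 := u.2.2
    exact ⟨unitInterval.toNNReal u * t, ⟨bot_le, mul_le_of_le_one_left bot_le hu⟩,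
      (h _ hu).symm.trans (σ.geod_coe _ _ u)⟩
  · rintro _ ⟨s, ⟨-, hs⟩, rfl⟩
    have hst : s / t * t = s := div_mul_cancel_of_imp fun ht => by simpa [ht] using hs
    have hst1 : s / t ≤ 1 := div_le_one_of_le₀ hs bot_le
    refine ⟨⟨(s / t : ℝ≥0), (s / t).coe_nonneg, mod_cast hst1⟩, ?_⟩
    exact (σ.geod_of_mem _ _ _).symm.trans ((h _ hst1).trans (congrArg γ hst))

theorem Ray.toFun_eq_of_asymptotic (hc : σ.IsConical) {ξ η : σ.Ray}
    (h0 : ξ.toFun 0 = η.toFun 0) (h : Asymptotic ξ η) : ξ.toFun = η.toFun := by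
  obtain ⟨C, hC⟩ := h
  funext t
  refine dist_le_zero.1 (le_of_forall_le_add_div (c := C) fun T hT => ?_)
  lift T to ℝ≥0 using zero_le_one.trans hT
  have hT0 : T ≠ 0 := (zero_lt_one.trans_le (mod_cast hT : 1 ≤ T)).ne'
  have htime (ζ : σ.Ray) : σ.geod (ζ.toFun 0) (ζ.toFun (T * t)) (T : ℝ)⁻¹ = ζ.toFun t := by
    rw [← NNReal.coe_inv, ζ.geod_eq _ (inv_le_one_of_one_le₀ (mod_cast hT)),
      inv_mul_cancel_left₀ hT0]
  calc dist (ξ.toFun t) (η.toFun t)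
      ≤ (T : ℝ)⁻¹ * dist (ξ.toFun (T * t)) (η.toFun (T * t)) := by
        rw [← htime ξ, ← htime η, ← h0]
        exact hc.dist_geod_le_of_left _ _ _ (inv_mem_Icc_of_one_le hT)
    _ ≤ (T : ℝ)⁻¹ * C := by gcongr; exact hC _
    _ = 0 + C / T := by rw [zero_add, div_eq_inv_mul]

theorem Ray.asymptotic_of_toBoundary_eq {ξ η : σ.Ray} {o : X}
    (h : ξ.toBoundary o = η.toBoundary o) : Asymptotic ξ η :=
  Quotient.exact (s := σ.asymptoticSetoid) h

theorem Ray.toBoundary_eq_of_asymptotic {ξ η : σ.Ray} (h : Asymptotic ξ η) (o : X) :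
    ξ.toBoundary o = η.toBoundary o :=
  Quotient.sound (s := σ.asymptoticSetoid) h

theorem isOpen_basicSet {o : X} {ξ : σ.Ray} (hξ : ξ.toFun 0 = o) (t : ℝ≥0) {ε : ℝ} (hε : 0 < ε) :
    IsOpen (basicSet o ξ t ε) :=
  TopologicalSpace.isOpen_generateFrom_of_mem ⟨ξ, t, ε, hξ, hε, rfl⟩

theorem toBoundary_mem_basicSet_iff (hc : σ.IsConical) {o : X} {η : σ.Ray} (hη : η.toFun 0 = o)
    (ξ : σ.Ray) (t : ℝ≥0) (ε : ℝ) :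
    η.toBoundary o ∈ basicSet o ξ t ε ↔ dist (η.toFun t) (ξ.toFun t) < ε := by
  refine ⟨?_, fun h => ⟨η, hη, rfl, h⟩⟩
  rintro ⟨η', hη', hclass, hlt⟩
  rwa [Ray.toFun_eq_of_asymptotic hc (hη'.trans hη.symm)
    (Ray.asymptotic_of_toBoundary_eq hclass)] at hlt

/-- The points of `∂_σ X` represented by a ray issuing from the basepoint. -/
def basedBoundary (σ : GeodesicBicombing X) (o : X) : Set (σ.Boundary o) :=
  {y | ∃ ξ : σ.Ray, ξ.toFun 0 = o ∧ ξ.toBoundary o = y}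

theorem IsConical.t2Space_basedBoundary (hc : σ.IsConical) (o : X) :
    T2Space (σ.basedBoundary o) := by
  refine ⟨?_⟩
  rintro ⟨_, ξ, hξ, rfl⟩ ⟨_, η, hη, rfl⟩ hne
  obtain ⟨t, ht⟩ : ∃ t, ξ.toFun t ≠ η.toFun t := by
    by_contra! heq
    exact hne (Subtype.ext (Ray.toBoundary_eq_of_asymptotic ⟨0, fun t => by simp [heq t]⟩ o))
  have hε := half_pos (dist_pos.2 ht)
  refine ⟨_, _, (isOpen_basicSet hξ t hε).preimage continuous_subtype_val,
    (isOpen_basicSet hη t hε).preimage continuous_subtype_val,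
    (toBoundary_mem_basicSet_iff hc hξ ξ t _).2 (by rwa [dist_self]),
    (toBoundary_mem_basicSet_iff hc hη η t _).2 (by rwa [dist_self]), ?_⟩
  rw [Set.disjoint_left]
  rintro ⟨_, ζ, hζ, rfl⟩ hζξ hζη
  have hξ_lt := (toBoundary_mem_basicSet_iff hc hζ ξ t _).1 hζξ
  have hη_lt := (toBoundary_mem_basicSet_iff hc hζ η t _).1 hζη
  linarith [dist_triangle_left (ξ.toFun t) (η.toFun t) (ζ.toFun t)]

end Ray

/-! ### Cones over normed spaces -/

section Cone

variable {V : Type*} [NormedAddCommGroup V] [NormedSpace ℝ V] {σ : GeodesicBicombing X}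
  {o : X} {R : V → X}

/-- A cone in `X` over the normed space `V` with apex `o`: a continuous, uniformly proper map
`R : V → X` taking each segment from `0` to `v`, affinely parametrized, to the `σ`-geodesic from
`o` to `R v`. Only radial segments are required to be mapped to geodesics, so `R` need not be a
flat. -/
structure IsCone (σ : GeodesicBicombing X) (o : X) (R : V → X) : Prop where
  geod_eq : ∀ v, ∀ t ∈ Set.Icc (0 : ℝ) 1, σ.geod o (R v) t = R (t • v)
  continuous : Continuous R
  isUniformlyProper : IsUniformlyProper R

namespace IsCone

theorem map_zero (h : IsCone σ o R) : R 0 = o := by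
  simpa using (h.geod_eq 0 0 (Set.left_mem_Icc.2 zero_le_one)).symm

theorem map_smul_eq_geod (h : IsCone σ o R) (v : V) {r M : ℝ} (hr : 0 ≤ r) (hrM : r ≤ M)
    (hM : 0 < M) : R (r • v) = σ.geod o (R (M • v)) (r / M) := by
  rw [h.geod_eq _ _ ⟨by positivity, (div_le_one hM).2 hrM⟩, smul_smul, div_mul_cancel₀ _ hM.ne']

theorem dist_apex_smul (h : IsCone σ o R) (v : V) {t : ℝ} (ht : 0 ≤ t) :
    dist o (R (t • v)) = t * dist o (R v) := by
  rcases le_total t 1 with ht1 | ht1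
  · rw [← h.geod_eq v t ⟨ht, ht1⟩, σ.dist_geod_left _ _ ⟨ht, ht1⟩]
  · have ht0 : t ≠ 0 := (zero_lt_one.trans_le ht1).ne'
    have hv : R v = σ.geod o (R (t • v)) t⁻¹ := by
      rw [h.geod_eq _ _ (inv_mem_Icc_of_one_le ht1), inv_smul_smul₀ ht0]
    rw [hv, σ.dist_geod_left _ _ (inv_mem_Icc_of_one_le ht1), mul_inv_cancel_left₀ ht0]

theorem dist_smul_smul (h : IsCone σ o R) (v : V) {s t : ℝ} (hs : 0 ≤ s) (ht : 0 ≤ t) :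
    dist (R (s • v)) (R (t • v)) = |s - t| * dist o (R v) := by
  have hM : 0 < s + t + 1 := by positivity
  rw [h.map_smul_eq_geod v hs (by linarith) hM, h.map_smul_eq_geod v ht (by linarith) hM,
    σ.dist_geod _ _ ⟨by positivity, (div_le_one hM).2 (by linarith)⟩
      ⟨by positivity, (div_le_one hM).2 (by linarith)⟩,
    h.dist_apex_smul v hM.le, ← sub_div, abs_div, abs_of_pos hM, ← mul_assoc,
    div_mul_cancel₀ _ hM.ne']

theorem eq_of_dist_smul_le (h : IsCone σ o R) {u v : V} {B : ℝ}
    (hB : ∀ t : ℝ≥0, dist (R ((t : ℝ) • u)) (R ((t : ℝ) • v)) ≤ B) : u = v := by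
  obtain ⟨B', hB'⟩ := h.isUniformlyProper B
  refine dist_le_zero.1 (le_of_forall_le_add_div (c := B') fun T hT => ?_)
  have hT0 : 0 < T := zero_lt_one.trans_le hT
  rw [zero_add, le_div_iff₀ hT0, mul_comm, ← Real.norm_of_nonneg hT0.le, ← dist_smul₀]
  exact hB' _ _ (hB ⟨T, hT0.le⟩)

theorem dist_apex_pos (h : IsCone σ o R) {v : V} (hv : v ≠ 0) : 0 < dist o (R v) := by
  refine dist_nonneg.lt_of_ne fun hdist => hv (h.eq_of_dist_smul_le (B := 0) fun t => ?_)
  rw [smul_zero, h.map_zero, dist_comm, h.dist_apex_smul v t.coe_nonneg, ← hdist, mul_zero]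

/-- The `σ`-ray `r ↦ R (r v)`. -/
def ray (h : IsCone σ o R) (v : V) (hv : dist o (R v) = 1) : σ.Ray where
  toFun r := R ((r : ℝ) • v)
  isometry := Isometry.of_dist_eq fun s t => by
    rw [h.dist_smul_smul v s.coe_nonneg t.coe_nonneg, hv, mul_one, NNReal.dist_eq]
  range_path t := range_path_eq_image_Icc (γ := fun r : ℝ≥0 => R ((r : ℝ) • v)) fun u hu => by
    rw [NNReal.coe_zero, zero_smul, h.map_zero, h.geod_eq _ _ ⟨u.coe_nonneg, mod_cast hu⟩,
      smul_smul, NNReal.coe_mul]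

theorem dist_apex_inv_smul (h : IsCone σ o R) {v : V} (hv : v ≠ 0) :
    dist o (R ((dist o (R v))⁻¹ • v)) = 1 := by
  rw [h.dist_apex_smul v (inv_nonneg.2 dist_nonneg), inv_mul_cancel₀ (h.dist_apex_pos hv).ne']

/-- The `σ`-ray in the direction of `v ≠ 0`: the parametrization of `r ↦ R (r v)` by arc length. -/
noncomputable def dirRay (h : IsCone σ o R) (v : V) (hv : v ≠ 0) : σ.Ray :=
  h.ray ((dist o (R v))⁻¹ • v) (h.dist_apex_inv_smul hv)

theorem dirRay_toFun (h : IsCone σ o R) (v : V) (hv : v ≠ 0) (r : ℝ≥0) :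
    (h.dirRay v hv).toFun r = R ((r : ℝ) • (dist o (R v))⁻¹ • v) := rfl

theorem dirRay_zero (h : IsCone σ o R) (v : V) (hv : v ≠ 0) :
    (h.dirRay v hv).toFun 0 = o := by
  rw [dirRay_toFun, NNReal.coe_zero, zero_smul, h.map_zero]

/-- The map from the unit sphere of `V` to `∂_σ X` sending `v` to the class of the ray in the
direction of `v`. -/
noncomputable def sphereMap (h : IsCone σ o R) (v : Metric.sphere (0 : V) 1) : σ.Boundary o :=
  (h.dirRay v (ne_zero_of_mem_unit_sphere v)).toBoundary o

theorem sphereMap_mem_basedBoundary (h : IsCone σ o R) (v : Metric.sphere (0 : V) 1) :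
    h.sphereMap v ∈ σ.basedBoundary o :=
  ⟨_, h.dirRay_zero _ _, rfl⟩

theorem continuous_sphereMap (h : IsCone σ o R) (hc : σ.IsConical) :
    Continuous h.sphereMap := by
  refine continuous_generateFrom_iff.2 ?_
  rintro _ ⟨ξ, t, ε, -, -, rfl⟩
  have hpre : h.sphereMap ⁻¹' basicSet o ξ t ε = {v : Metric.sphere (0 : V) 1 |
      dist (R ((t : ℝ) • (dist o (R v))⁻¹ • (v : V))) (ξ.toFun t) < ε} :=
    Set.ext fun v => toBoundary_mem_basicSet_iff hc (h.dirRay_zero _ _) ξ t ε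
  have hR := h.continuous
  have hinv : Continuous fun v : Metric.sphere (0 : V) 1 => (dist o (R v))⁻¹ :=
    Continuous.inv₀ (by fun_prop) fun v => (h.dist_apex_pos (ne_zero_of_mem_unit_sphere v)).ne'
  rw [hpre]
  exact isOpen_lt (by fun_prop) continuous_const

theorem injective_sphereMap (h : IsCone σ o R) : Function.Injective h.sphereMap := by
  intro v w hvw
  obtain ⟨B, hB⟩ := Ray.asymptotic_of_toBoundary_eq hvw
  have hdir : (dist o (R v))⁻¹ • (v : V) = (dist o (R w))⁻¹ • (w : V) := h.eq_of_dist_smul_le hB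
  have hscale : (dist o (R v))⁻¹ = (dist o (R w))⁻¹ := by
    simpa [norm_smul] using congrArg norm hdir
  rw [hscale] at hdir
  have hw := h.dist_apex_pos (ne_zero_of_mem_unit_sphere w)
  exact Subtype.ext (smul_right_injective V (inv_pos.2 hw).ne' hdir)

theorem isEmbedding_sphereMap [ProperSpace V] (h : IsCone σ o R) (hc : σ.IsConical) :
    Topology.IsEmbedding h.sphereMap := by
  have := hc.t2Space_basedBoundary o
  have hcont : Continuous (Set.codRestrict h.sphereMap _ h.sphereMap_mem_basedBoundary) :=
    (h.continuous_sphereMap hc).codRestrict _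
  exact Topology.IsEmbedding.subtypeVal.comp
    (hcont.isClosedEmbedding (h.injective_sphereMap.codRestrict _)).isEmbedding

theorem dist_smul_ray_le (h : IsCone σ o R) (hc : σ.IsConical) (ζ : σ.Ray) {v : V} {T s : ℝ≥0}
    (hT : T ≠ 0) (hs : s ≤ T) :
    dist (R ((s : ℝ) • (T : ℝ)⁻¹ • v)) (ζ.toFun s) ≤
      dist o (ζ.toFun 0) + dist (R v) (ζ.toFun T) := by
  have hu : s * T⁻¹ ≤ 1 := by
    rw [← div_eq_mul_inv]
    exact div_le_one_of_le₀ hs bot_le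
  have hu' : ((s * T⁻¹ : ℝ≥0) : ℝ) ∈ Set.Icc (0 : ℝ) 1 := ⟨NNReal.coe_nonneg _, mod_cast hu⟩
  have hR : R ((s : ℝ) • (T : ℝ)⁻¹ • v) = σ.geod o (R v) (s * T⁻¹ : ℝ≥0) := by
    rw [h.geod_eq v _ hu', smul_smul, NNReal.coe_mul, NNReal.coe_inv]
  have hζ : ζ.toFun s = σ.geod (ζ.toFun 0) (ζ.toFun T) (s * T⁻¹ : ℝ≥0) := by
    rw [ζ.geod_eq T hu, inv_mul_cancel_right₀ hT]
  rw [hR, hζ]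
  exact (hc.dist_geod_le _ _ _ _ hu').trans (add_le_add
    (mul_le_of_le_one_left dist_nonneg (sub_le_self _ hu'.1))
    (mul_le_of_le_one_left dist_nonneg hu'.2))

/-- Points of the cone near `ζ(T)`, rescaled by `T⁻¹`, subconverge as `T → ∞` to the direction
sought. -/
theorem exists_dist_smul_ray_le [ProperSpace V] (h : IsCone σ o R) (hc : σ.IsConical) {D : ℝ}
    (hD : ∀ x, ∃ v, dist (R v) x ≤ D) (ζ : σ.Ray) :
    ∃ u : V, ∃ C : ℝ, ∀ s : ℝ≥0, dist (R ((s : ℝ) • u)) (ζ.toFun s) ≤ C := by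
  choose v hv using fun k : ℕ => hD (ζ.toFun (k + 1))
  let w : ℕ → V := fun k => ((k + 1 : ℝ≥0) : ℝ)⁻¹ • v k
  have hw (s : ℝ≥0) (k : ℕ) (hsk : s ≤ k + 1) :
      dist (R ((s : ℝ) • w k)) (ζ.toFun s) ≤ dist o (ζ.toFun 0) + D :=
    (h.dist_smul_ray_le hc ζ (by positivity) hsk).trans (by gcongr; exact hv k)
  obtain ⟨B, hB⟩ := h.isUniformlyProper (dist o (ζ.toFun 0) + D + dist (ζ.toFun 1) o)
  have hbounded (k : ℕ) : w k ∈ Metric.closedBall (0 : V) B := by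
    refine hB _ _ ((dist_triangle _ (ζ.toFun 1) _).trans ?_)
    rw [h.map_zero]
    gcongr
    simpa using hw 1 k (by simp)
  obtain ⟨u, -, φ, hφ, hu⟩ := (isCompact_closedBall (0 : V) B).tendsto_subseq hbounded
  refine ⟨u, dist o (ζ.toFun 0) + D, fun s => ?_⟩
  have hR := h.continuous
  have hcont : Continuous fun x : V => dist (R ((s : ℝ) • x)) (ζ.toFun s) := by fun_prop
  refine le_of_tendsto ((hcont.tendsto u).comp hu) ?_
  obtain ⟨k, hk⟩ := exists_nat_ge s
  filter_upwards [Filter.eventually_ge_atTop k] with j hj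
  refine hw s (φ j) (hk.trans ?_)
  exact_mod_cast (hj.trans (hφ.id_le j)).trans (Nat.le_succ _)

theorem dist_apex_eq_one_of_dist_smul_ray_le (h : IsCone σ o R) {ζ : σ.Ray} {u : V} {C : ℝ}
    (hC : ∀ s : ℝ≥0, dist (R ((s : ℝ) • u)) (ζ.toFun s) ≤ C) : dist o (R u) = 1 := by
  rw [← sub_eq_zero, ← abs_nonpos_iff]
  refine le_of_forall_le_add_div (c := dist o (ζ.toFun 0) + C) fun T hT => ?_
  have hT0 : 0 < T := zero_lt_one.trans_le hT
  lift T to ℝ≥0 using hT0.le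
  have hζ : dist (ζ.toFun 0) (ζ.toFun T) = T := by
    rw [ζ.isometry.dist_eq, dist_comm, NNReal.dist_eq, NNReal.coe_zero, sub_zero, NNReal.abs_eq]
  rw [zero_add, le_div_iff₀ hT0]
  calc |dist o (R u) - 1| * T = |dist o (R ((T : ℝ) • u)) - dist (ζ.toFun 0) (ζ.toFun T)| := by
        rw [h.dist_apex_smul u hT0.le, hζ, ← abs_of_pos hT0, ← abs_mul, abs_of_pos hT0]
        ring_nf
    _ ≤ dist o (ζ.toFun 0) + dist (R ((T : ℝ) • u)) (ζ.toFun T) := dist_dist_dist_le _ _ _ _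
    _ ≤ dist o (ζ.toFun 0) + C := by gcongr; exact hC T

theorem surjective_sphereMap [ProperSpace V] (h : IsCone σ o R) (hc : σ.IsConical)
    {D : ℝ} (hD : ∀ x, ∃ v, dist (R v) x ≤ D) : Function.Surjective h.sphereMap := by
  intro y
  obtain ⟨ζ, rfl⟩ : ∃ ζ : σ.Ray, ζ.toBoundary o = y := Quotient.exists_rep y
  obtain ⟨u, C, hC⟩ := h.exists_dist_smul_ray_le hc hD ζ
  have hunit := h.dist_apex_eq_one_of_dist_smul_ray_le hC
  have hu : u ≠ 0 := by
    rintro rfl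
    simp [h.map_zero] at hunit
  have hspeed : dist o (R (‖u‖⁻¹ • u)) = ‖u‖⁻¹ := by
    rw [h.dist_apex_smul u (inv_nonneg.2 (norm_nonneg u)), hunit, mul_one]
  refine ⟨⟨‖u‖⁻¹ • u, by simp [norm_smul, hu]⟩, Ray.toBoundary_eq_of_asymptotic ⟨C, fun t => ?_⟩ o⟩
  rw [dirRay_toFun, hspeed, inv_inv, smul_inv_smul₀ (norm_ne_zero_iff.2 hu)]
  exact hC t

end IsCone

end Cone

/-! ### Coarse cones -/

section CoarseCone

variable {V : Type*} [NormedAddCommGroup V] [NormedSpace ℝ V] {σ : GeodesicBicombing X}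
  {o : X} {f : V → X}

/-- The coarse counterpart of `IsCone`: radial segments are mapped to within bounded distance of
`σ`-geodesics, and continuity is replaced by a Lipschitz bound up to an additive constant. -/
structure IsCoarseCone (σ : GeodesicBicombing X) (o : X) (f : V → X) : Prop where
  dist_geod_le : ∃ C : ℝ, ∀ v, ∀ t ∈ Set.Icc (0 : ℝ) 1, dist (σ.geod o (f v) t) (f (t • v)) ≤ C
  dist_le : ∃ K : ℝ, ∀ v w, dist (f v) (f w) ≤ K * (dist v w + 1)
  isUniformlyProper : IsUniformlyProper f

/-- The map `f` seen from distance `T`: the scale of `V` is multiplied by `T`, and the homothety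
of `X` by `T⁻¹` is replaced by contraction along `σ`-geodesics towards `o`. -/
noncomputable def rescale (σ : GeodesicBicombing X) (o : X) (f : V → X) (T : ℝ) (v : V) : X :=
  σ.geod o (f (T • v)) T⁻¹

theorem rescale_one (σ : GeodesicBicombing X) (o : X) (f : V → X) (v : V) :
    σ.rescale o f 1 v = f v := by
  rw [rescale, one_smul, inv_one, geod_one]

theorem IsConsistent.geod_rescale (h : σ.IsConsistent) (v : V) {t T : ℝ} (ht0 : 0 < t)
    (ht1 : t ≤ 1) (hT : 1 ≤ T) :
    σ.geod o (σ.rescale o f T v) t = σ.rescale o f (T / t) (t • v) := by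
  rw [rescale, rescale, h.geod_geod _ _ (inv_mem_Icc_of_one_le hT) ⟨ht0.le, ht1⟩, smul_smul,
    div_mul_cancel₀ _ ht0.ne', inv_div, div_eq_mul_inv]

theorem IsCCC.dist_rescale_le (hσ : σ.IsCCC) {C : ℝ}
    (hC : ∀ v, ∀ t ∈ Set.Icc (0 : ℝ) 1, dist (σ.geod o (f v) t) (f (t • v)) ≤ C) (v : V)
    {T T' : ℝ} (hT : 1 ≤ T) (hTT' : T ≤ T') :
    dist (σ.rescale o f T v) (σ.rescale o f T' v) ≤ C / T := by
  have hT0 : 0 < T := zero_lt_one.trans_le hT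
  have hT'0 : 0 < T' := hT0.trans_le hTT'
  have hquot : T / T' ∈ Set.Icc (0 : ℝ) 1 := ⟨by positivity, div_le_one_of_le₀ hTT' hT'0.le⟩
  have hfactor : σ.rescale o f T' v = σ.geod o (σ.geod o (f (T' • v)) (T / T')) T⁻¹ := by
    rw [rescale, hσ.consistent.geod_geod _ _ hquot (inv_mem_Icc_of_one_le hT), ← mul_div_assoc,
      inv_mul_cancel₀ hT0.ne', one_div]
  have hclose := hC (T' • v) _ hquot
  rw [smul_smul, div_mul_cancel₀ _ hT'0.ne', dist_comm] at hclose
  rw [hfactor, div_eq_inv_mul C T]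
  exact (hσ.conical.dist_geod_le_of_left _ _ _ (inv_mem_Icc_of_one_le hT)).trans
    (mul_le_mul_of_nonneg_left hclose (inv_mem_Icc_of_one_le hT).1)

theorem IsCCC.exists_dist_rescale_le [CompleteSpace X] (hσ : σ.IsCCC) {C : ℝ}
    (hC : ∀ v, ∀ t ∈ Set.Icc (0 : ℝ) 1, dist (σ.geod o (f v) t) (f (t • v)) ≤ C) :
    ∃ R : V → X, ∀ v T, 1 ≤ T → dist (σ.rescale o f T v) (R v) ≤ C / T := by
  suffices hlim : ∀ v, ∃ p, ∀ T, 1 ≤ T → dist (σ.rescale o f T v) p ≤ C / T from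
    Classical.skolem.1 hlim
  intro v
  have hnull : Filter.Tendsto (fun k : ℕ => C / ((k : ℝ) + 1)) Filter.atTop (nhds 0) :=
    tendsto_const_nhds.div_atTop
      (Filter.tendsto_atTop_add_const_right _ _ tendsto_natCast_atTop_atTop)
  have hcauchy : CauchySeq fun k : ℕ => σ.rescale o f ((k : ℝ) + 1) v :=
    cauchySeq_of_le_tendsto_0' _
      (fun m k hmk => hσ.dist_rescale_le hC v (by linarith [m.cast_nonneg (α := ℝ)]) (by gcongr))
      hnull
  obtain ⟨p, hp⟩ := cauchySeq_tendsto_of_complete hcauchy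
  refine ⟨p, fun T hT => le_of_tendsto (tendsto_const_nhds.dist hp) ?_⟩
  obtain ⟨k, hk⟩ := exists_nat_ge T
  filter_upwards [Filter.eventually_ge_atTop k] with j hj
  have hkj : (k : ℝ) ≤ j := mod_cast hj
  exact hσ.dist_rescale_le hC v hT (by linarith)

theorem map_zero_of_dist_rescale_le {R : V → X} {C : ℝ}
    (hR : ∀ v T, 1 ≤ T → dist (σ.rescale o f T v) (R v) ≤ C / T) : R 0 = o := by
  refine (dist_le_zero.1 (le_of_forall_le_add_div (c := dist o (f 0) + C) fun T hT => ?_)).symm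
  calc dist o (R 0) ≤ dist o (σ.rescale o f T 0) + dist (σ.rescale o f T 0) (R 0) :=
        dist_triangle _ _ _
    _ ≤ T⁻¹ * dist o (f 0) + C / T := by
        gcongr
        · rw [rescale, smul_zero, σ.dist_geod_left _ _ (inv_mem_Icc_of_one_le hT)]
        · exact hR 0 T hT
    _ = 0 + (dist o (f 0) + C) / T := by ring

theorem IsCCC.geod_eq_of_dist_rescale_le (hσ : σ.IsCCC) {R : V → X} {C : ℝ}
    (hR : ∀ v T, 1 ≤ T → dist (σ.rescale o f T v) (R v) ≤ C / T) (v : V) {t : ℝ}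
    (ht : t ∈ Set.Icc (0 : ℝ) 1) : σ.geod o (R v) t = R (t • v) := by
  rcases ht.1.eq_or_lt with rfl | ht0
  · rw [geod_zero, zero_smul, map_zero_of_dist_rescale_le hR]
  refine dist_le_zero.1 (le_of_forall_le_add_div (c := 2 * t * C) fun T hT => ?_)
  calc dist (σ.geod o (R v) t) (R (t • v))
      ≤ dist (σ.geod o (R v) t) (σ.geod o (σ.rescale o f T v) t) +
          dist (σ.rescale o f (T / t) (t • v)) (R (t • v)) := by
        rw [← hσ.consistent.geod_rescale v ht0 ht.2 hT]
        exact dist_triangle _ _ _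
    _ ≤ t * (C / T) + C / (T / t) := by
        gcongr
        · refine (hσ.conical.dist_geod_le_of_left _ _ _ ht).trans ?_
          rw [dist_comm]
          gcongr
          exact hR v T hT
        · exact hR _ _ ((one_le_div ht0).2 (ht.2.trans hT))
    _ = 0 + 2 * t * C / T := by
        field_simp
        ring

/-- Applying the coarse bound at scale `T` and contracting by `T⁻¹` makes the additive constants
disappear as `T → ∞`. -/
theorem IsConical.dist_le_of_dist_le_add (hc : σ.IsConical) {R : V → X} {K C : ℝ}
    (hgeod : ∀ v, ∀ t ∈ Set.Icc (0 : ℝ) 1, σ.geod o (R v) t = R (t • v))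
    (hR : ∀ v w, dist (R v) (R w) ≤ K * dist v w + C) (v w : V) :
    dist (R v) (R w) ≤ K * dist v w := by
  refine le_of_forall_le_add_div (c := C) fun T hT => ?_
  have hT0 : 0 < T := zero_lt_one.trans_le hT
  have hunscale (u : V) : R u = σ.geod o (R (T • u)) T⁻¹ := by
    rw [hgeod _ _ (inv_mem_Icc_of_one_le hT), inv_smul_smul₀ hT0.ne']
  calc dist (R v) (R w) ≤ T⁻¹ * dist (R (T • v)) (R (T • w)) := by
        rw [hunscale v, hunscale w]
        exact hc.dist_geod_le_of_left _ _ _ (inv_mem_Icc_of_one_le hT)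
    _ ≤ T⁻¹ * (K * (T * dist v w) + C) := by
        gcongr
        simpa only [dist_smul₀, Real.norm_of_nonneg hT0.le] using hR (T • v) (T • w)
    _ = K * dist v w + C / T := by
        field_simp

theorem IsCoarseCone.exists_isCone [CompleteSpace X] (h : IsCoarseCone σ o f) (hσ : σ.IsCCC) :
    ∃ R : V → X, IsCone σ o R ∧ ∃ C, ∀ v, dist (f v) (R v) ≤ C := by
  obtain ⟨C, hC⟩ := h.dist_geod_le
  obtain ⟨K, hK⟩ := h.dist_le
  obtain ⟨R, hR⟩ := hσ.exists_dist_rescale_le hC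
  have hfR (v : V) : dist (f v) (R v) ≤ C := by simpa [rescale_one] using hR v 1 le_rfl
  have hgeod (v : V) (t : ℝ) (ht : t ∈ Set.Icc (0 : ℝ) 1) : σ.geod o (R v) t = R (t • v) :=
    hσ.geod_eq_of_dist_rescale_le hR v ht
  have hcoarse (v w : V) : dist (R v) (R w) ≤ K * dist v w + (K + 2 * C) := by
    have := dist_triangle4 (R v) (f v) (f w) (R w)
    linarith [dist_comm (R v) (f v), hfR v, hK v w, hfR w]
  have hlip := hσ.conical.dist_le_of_dist_le_add hgeod hcoarse
  exact ⟨R, ⟨hgeod, (LipschitzWith.of_dist_le' hlip).continuous,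
    h.isUniformlyProper.of_dist_le hfR⟩, C, hfR⟩

end CoarseCone

end GeodesicBicombing

/-! ### Discounted averages -/

section DiscountedAverage

theorem nonpos_of_le_mul_average {W : Type*} {u : W → ℝ} (hu : BddAbove (Set.range u)) {c t : ℝ}
    (hc0 : 0 ≤ c) (hc1 : c < 1) (ht : t ∈ Set.Icc (0 : ℝ) 1) (α β : W → W)
    (h : ∀ w, u w ≤ c * ((1 - t) * u (α w) + t * u (β w))) (w : W) : u w ≤ 0 := by
  have : Nonempty W := ⟨w⟩
  have hle (v : W) : u v ≤ ⨆ v, u v := le_ciSup hu v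
  have hsup : ⨆ v, u v ≤ c * ⨆ v, u v := by
    refine ciSup_le fun v => (h v).trans (mul_le_mul_of_nonneg_left ?_ hc0)
    nlinarith [mul_le_mul_of_nonneg_left (hle (α v)) (sub_nonneg.2 ht.2),
      mul_le_mul_of_nonneg_left (hle (β v)) ht.1]
  nlinarith [hle w]

theorem le_of_le_add_mul_average {W : Type*} {u v g : W → ℝ}
    (huv : BddAbove (Set.range (u - v))) {c t : ℝ}
    (hc0 : 0 ≤ c) (hc1 : c < 1) (ht : t ∈ Set.Icc (0 : ℝ) 1) (α β : W → W)
    (hu : ∀ w, u w ≤ g w + c * ((1 - t) * u (α w) + t * u (β w)))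
    (hv : ∀ w, g w + c * ((1 - t) * v (α w) + t * v (β w)) ≤ v w) : u ≤ v := by
  refine fun w => sub_nonpos.1 (nonpos_of_le_mul_average huv hc0 hc1 ht α β (fun w => ?_) w)
  simp only [Pi.sub_apply]
  linarith [hu w, hv w]

theorem average_sq_le {B ε t : ℝ} (hε : 0 < ε) (ht : t ∈ Set.Icc (0 : ℝ) 1) {a b : ℝ}
    (hab : |t * a - b| ≤ B) (s : ℝ) :
    (1 - t) * (s + b) ^ 2 + t * (s + b - a) ^ 2 ≤
      (1 + ε / 2) * s ^ 2 + (1 + 2 / ε) * B ^ 2 + a ^ 2 := by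
  have hdrift : (t * a - b) ^ 2 ≤ B ^ 2 := sq_le_sq' (abs_le.1 hab).1 (abs_le.1 hab).2
  have hvar : t * (1 - t) * a ^ 2 ≤ a ^ 2 :=
    mul_le_of_le_one_left (sq_nonneg a) (by nlinarith [ht.1, ht.2])
  have hyoung : (s - (t * a - b)) ^ 2 ≤ (1 + ε / 2) * s ^ 2 + (1 + 2 / ε) * (t * a - b) ^ 2 := by
    have hsquare : 0 ≤ (ε * s + 2 * (t * a - b)) ^ 2 / (2 * ε) := by positivity
    have hexpand : (1 + ε / 2) * s ^ 2 + (1 + 2 / ε) * (t * a - b) ^ 2 - (s - (t * a - b)) ^ 2 =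
        (ε * s + 2 * (t * a - b)) ^ 2 / (2 * ε) := by
      field_simp
      ring
    linarith
  calc (1 - t) * (s + b) ^ 2 + t * (s + b - a) ^ 2
      = (s - (t * a - b)) ^ 2 + t * (1 - t) * a ^ 2 := by ring
    _ ≤ (1 + ε / 2) * s ^ 2 + (1 + 2 / ε) * B ^ 2 + a ^ 2 := by
      have := mul_le_mul_of_nonneg_left hdrift (by positivity : 0 ≤ 1 + 2 / ε)
      linarith

theorem mul_abs_le_sq_mul_sq_add (ε s : ℝ) : ε * |s| ≤ ε ^ 2 * s ^ 2 + 1 / 4 := by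
  nlinarith [sq_nonneg (ε * |s| - 1 / 2), sq_abs s]

theorem quadratic_supersolution {B ε t : ℝ} (hε : 0 < ε) (hε1 : ε ≤ 1)
    (ht : t ∈ Set.Icc (0 : ℝ) 1) {a b q : ℝ} (hab : |t * a - b| ≤ B)
    (hq : 1 / 4 + 4 * B ^ 2 + 2 * ε * a ^ 2 ≤ ε * q) (s : ℝ) :
    ε * |s| + (1 - ε) * ((1 - t) * (2 * ε * (s + b) ^ 2 + q) +
      t * (2 * ε * (s + b - a) ^ 2 + q)) ≤ 2 * ε * s ^ 2 + q := by
  have havg := mul_le_mul_of_nonneg_left (average_sq_le hε ht hab s)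
    (by nlinarith : 0 ≤ 2 * ε * (1 - ε))
  have hdiv : 2 * ε * (1 - ε) * ((1 + ε / 2) * s ^ 2 + (1 + 2 / ε) * B ^ 2 + a ^ 2) =
      2 * ε * s ^ 2 - ε ^ 2 * (1 + ε) * s ^ 2 + 2 * (1 - ε) * (ε + 2) * B ^ 2 +
        2 * ε * (1 - ε) * a ^ 2 := by
    field_simp
    ring
  nlinarith [mul_abs_le_sq_mul_sq_add ε s, mul_nonneg (pow_nonneg hε.le 3) (sq_nonneg s),
    mul_nonneg hε.le (sq_nonneg B), mul_nonneg (sq_nonneg ε) (sq_nonneg B),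
    mul_nonneg (sq_nonneg ε) (sq_nonneg a)]

theorem abs_le_quadratic {ε q : ℝ} (hε : 0 < ε) (hq : 1 / 4 ≤ ε * q) (s : ℝ) :
    |s| ≤ 2 * ε * s ^ 2 + q := by
  refine le_of_mul_le_mul_left ?_ hε
  nlinarith [mul_abs_le_sq_mul_sq_add ε s, sq_nonneg (ε * s)]

/-- Comparison with the supersolution `w ↦ ∑ i, L * (2 * ε * (w i) ^ 2 + q i)`, where `q i` is
chosen so that `ε * q i = 1 / 4 + 4 * B ^ 2 + 2 * ε * (a i) ^ 2`. -/
theorem mul_apply_zero_le_of_le_discounted_average {ι : Type*} [Fintype ι] {u : (ι → ℤ) → ℝ}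
    {L M B ε t : ℝ} (hL : 0 ≤ L) (hε : 0 < ε) (hε1 : ε < 1) (ht : t ∈ Set.Icc (0 : ℝ) 1)
    {a b : ι → ℤ} (hab : ∀ i, |t * a i - b i| ≤ B)
    (hgrowth : ∀ w, u w ≤ L * ∑ i, |(w i : ℝ)| + M)
    (hu : ∀ w, u w ≤ ε * (L * ∑ i, |(w i : ℝ)|) +
      (1 - ε) * ((1 - t) * u (w + b) + t * u (w + b - a))) :
    ε * u 0 ≤ L * ∑ i, (1 / 4 + 4 * B ^ 2 + 2 * ε * (a i : ℝ) ^ 2) := by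
  set q : ι → ℝ := fun i => (1 / 4 + 4 * B ^ 2 + 2 * ε * (a i : ℝ) ^ 2) / ε
  have hq (i : ι) : ε * q i = 1 / 4 + 4 * B ^ 2 + 2 * ε * (a i : ℝ) ^ 2 :=
    mul_div_cancel₀ _ hε.ne'
  set v : (ι → ℤ) → ℝ := fun w => L * ∑ i, (2 * ε * (w i : ℝ) ^ 2 + q i)
  have hbdd : BddAbove (Set.range (u - v)) := by
    refine ⟨M, Set.forall_mem_range.2 fun w => ?_⟩
    have hv : L * ∑ i, |(w i : ℝ)| ≤ v w := by
      refine mul_le_mul_of_nonneg_left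
        (Finset.sum_le_sum fun i _ => abs_le_quadratic hε ?_ _) hL
      rw [hq, add_assoc]
      exact le_add_of_nonneg_right (by positivity)
    rw [Pi.sub_apply]
    linarith [hgrowth w]
  have hsuper (w : ι → ℤ) : ε * (L * ∑ i, |(w i : ℝ)|) +
      (1 - ε) * ((1 - t) * v (w + b) + t * v (w + b - a)) ≤ v w := by
    have hsum := Finset.sum_le_sum fun i (_ : i ∈ Finset.univ) =>
      quadratic_supersolution hε hε1.le ht (hab i) (hq i).ge (w i : ℝ)
    simp only [Finset.sum_add_distrib, ← Finset.mul_sum] at hsum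
    have := mul_le_mul_of_nonneg_left hsum hL
    simp only [v, Pi.add_apply, Pi.sub_apply, Int.cast_add, Int.cast_sub, Finset.sum_add_distrib,
      ← Finset.mul_sum]
    linarith
  have hcomp := le_of_le_add_mul_average hbdd (sub_nonneg.2 hε1.le) (sub_lt_self 1 hε) ht
    (· + b) (· + b - a) hu hsuper 0
  calc ε * u 0 ≤ ε * v 0 := mul_le_mul_of_nonneg_left hcomp hε.le
    _ = L * ∑ i, (1 / 4 + 4 * B ^ 2 + 2 * ε * (a i : ℝ) ^ 2) := by
      simp [v, mul_left_comm ε L, Finset.mul_sum, hq]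

end DiscountedAverage

/-! ### Geometric actions -/

section Isometric

variable {G X : Type*} [Group G] [MetricSpace X] [MulAction G X]

theorem dist_conj_smul [IsIsometricSMul G X] (g s : G) (x : X) :
    dist x ((g⁻¹ * s * g) • x) = dist (g • x) (s • g • x) := by
  rw [← dist_smul g x, smul_smul, smul_smul, mul_assoc g⁻¹, mul_inv_cancel_left]

/-- The set of points displaced by at most `R` by each element of `S`. -/
def displacementSublevel (X : Type*) [MetricSpace X] [MulAction G X] (S : Set G) (R : ℝ) : Set X :=
  {x | ∀ s ∈ S, dist x (s • x) ≤ R}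

theorem isClosed_displacementSublevel [ContinuousConstSMul G X] (S : Set G) (R : ℝ) :
    IsClosed (displacementSublevel X S R) := by
  simp only [displacementSublevel, Set.ofPred_forall]
  exact isClosed_biInter fun s _ =>
    isClosed_le (continuous_id.dist (continuous_const_smul s)) continuous_const

/-- Two elements conjugating `S` in the same way differ by an element of the centralizer. -/
theorem exists_finite_mul_inv_mem_centralizer {S F : Set G} (hS : S.Finite)
    (hF : F.Finite) : ∃ T : Set G, T.Finite ∧ ∀ g, (∀ s ∈ S, g⁻¹ * s * g ∈ F) →
      ∃ t ∈ T, g * t⁻¹ ∈ Subgroup.centralizer S := by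
  have := hS.to_subtype
  let conj : G → S → G := fun g s => g⁻¹ * s * g
  obtain ⟨T, -, hT⟩ := Set.exists_subset_bijOn {g | ∀ s, conj g s ∈ F} conj
  have himage : conj '' {g | ∀ s, conj g s ∈ F} ⊆ {k | ∀ s, k s ∈ F} :=
    Set.image_subset_iff.2 subset_rfl
  refine ⟨T, hT.finite_iff_finite.2 ((Set.Finite.pi' fun _ => hF).subset himage), fun g hg => ?_⟩
  obtain ⟨t, ht, hconj⟩ := hT.surjOn ⟨g, fun s => hg s s.2, rfl⟩
  refine ⟨t, ht, Subgroup.mem_centralizer_iff.2 fun s hs => ?_⟩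
  have hts : t⁻¹ * s * t = g⁻¹ * s * g := congrFun hconj ⟨s, hs⟩
  calc s * (g * t⁻¹) = g * (g⁻¹ * s * g) * t⁻¹ := by group
    _ = g * (t⁻¹ * s * t) * t⁻¹ := by rw [hts]
    _ = g * t⁻¹ * s := by group

end Isometric

namespace IsGeometricAction

variable {G X : Type*} [Group G] [MetricSpace X] [MulAction G X]

theorem isIsometricSMul (h : IsGeometricAction G X) : IsIsometricSMul G X :=
  ⟨h.isometry⟩

theorem finite_setOf_dist_le [ProperSpace X] (h : IsGeometricAction G X) (o : X) (R : ℝ) :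
    {g : G | dist o (g • o) ≤ R}.Finite :=
  (h.proper _ (isCompact_closedBall o R)).subset fun g hg =>
    ⟨g • o, ⟨o, Metric.mem_closedBall_self (dist_nonneg.trans hg), rfl⟩,
      Metric.mem_closedBall'.2 hg⟩

theorem exists_dist_smul_le (h : IsGeometricAction G X) (o : X) :
    ∃ D, ∀ x, ∃ g : G, dist x (g • o) ≤ D := by
  have := h.isIsometricSMul
  have := h.cocompact
  let _ := MulAction.orbitRel G X
  have hcover : (Set.univ : Set (Quotient (MulAction.orbitRel G X))) ⊆
      ⋃ k : ℕ, Quotient.mk _ '' Metric.ball o k := by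
    rintro y -
    obtain ⟨x, rfl⟩ := Quotient.exists_rep y
    obtain ⟨k, hk⟩ := exists_nat_gt (dist x o)
    exact Set.mem_iUnion.2 ⟨k, x, hk, rfl⟩
  have hmono : Monotone fun k : ℕ =>
      (Quotient.mk _ '' Metric.ball o k : Set (Quotient (MulAction.orbitRel G X))) :=
    fun i j hij => Set.image_mono (Metric.ball_subset_ball (mod_cast hij))
  obtain ⟨k, hk⟩ := isCompact_univ.elim_directed_cover _
    (fun k => isOpenMap_quotient_mk'_mul _ Metric.isOpen_ball) hcover hmono.directed_le
  refine ⟨k, fun x => ?_⟩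
  obtain ⟨y, hy, hyx⟩ := hk (Set.mem_univ (Quotient.mk _ x))
  obtain ⟨g, rfl⟩ : y ∈ MulAction.orbit G x := Quotient.exact hyx
  refine ⟨g⁻¹, ?_⟩
  rw [← dist_smul g, smul_inv_smul]
  exact (Metric.mem_ball.1 hy).le

theorem exists_dist_smul_le_of_finiteIndex (h : IsGeometricAction G X) (A : Subgroup G)
    [A.FiniteIndex] (o : X) : ∃ D, ∀ x, ∃ a ∈ A, dist x (a • o) ≤ D := by
  have := h.isIsometricSMul
  obtain ⟨D, hD⟩ := h.exists_dist_smul_le o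
  obtain ⟨M, hM⟩ := (Set.finite_range fun q : G ⧸ A => dist (q.out • o) o).bddAbove
  refine ⟨D + M, fun x => ?_⟩
  obtain ⟨g, hg⟩ := hD x
  have hmem : g * (QuotientGroup.mk g⁻¹ : G ⧸ A).out ∈ A := by
    rw [← inv_inv g, ← QuotientGroup.eq, QuotientGroup.out_eq', inv_inv]
  refine ⟨_, hmem, (dist_triangle _ (g • o) _).trans (add_le_add hg ?_)⟩
  rw [mul_smul, dist_smul, dist_comm]
  exact hM ⟨_, rfl⟩

theorem exists_mem_centralizer_dist_le [ProperSpace X] (h : IsGeometricAction G X) (o : X)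
    {S : Set G} (hS : S.Finite) (R : ℝ) :
    ∃ D, ∀ x ∈ displacementSublevel X S R, ∃ c ∈ Subgroup.centralizer S, dist x (c • o) ≤ D := by
  have := h.isIsometricSMul
  obtain ⟨D, hD⟩ := h.exists_dist_smul_le o
  obtain ⟨T, hTfin, hT⟩ :=
    exists_finite_mul_inv_mem_centralizer hS (h.finite_setOf_dist_le o (D + R + D))
  obtain ⟨M, hM⟩ := (hTfin.image fun t => dist o (t⁻¹ • o)).bddAbove
  refine ⟨D + M, fun x hx => ?_⟩
  obtain ⟨g, hg⟩ := hD x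
  have hconj (s : G) (hs : s ∈ S) : dist o ((g⁻¹ * s * g) • o) ≤ D + R + D :=
    calc dist o ((g⁻¹ * s * g) • o) = dist (g • o) (s • g • o) := dist_conj_smul g s o
      _ ≤ dist (g • o) x + dist x (s • x) + dist (s • x) (s • g • o) := dist_triangle4 _ _ _ _
      _ ≤ D + R + D := by
        rw [dist_smul, dist_comm (g • o) x]
        exact add_le_add_three hg (hx s hs) hg
  obtain ⟨t, ht, hmem⟩ := hT g hconj
  refine ⟨_, hmem, (dist_triangle _ (g • o) _).trans (add_le_add hg ?_)⟩
  rw [mul_smul, dist_smul]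
  exact hM ⟨t, ht, rfl⟩

end IsGeometricAction

/-! ### Orbits of free abelian groups -/

section Orbit

theorem addGroupSeminorm_apply_le_sum {ι : Type*} [Fintype ι] [DecidableEq ι]
    (p : AddGroupSeminorm (ι → ℤ)) (a : ι → ℤ) :
    p a ≤ ∑ i, |(a i : ℝ)| * p (Pi.single i 1) := by
  let _ := AddGroupSeminormClass.toSeminormedAddCommGroup p
  have hsingle (i : ι) : p (Pi.single i (a i)) ≤ |(a i : ℝ)| * p (Pi.single i 1) := by
    rw [← Int.norm_eq_abs, ← mul_one (a i), ← smul_eq_mul, Pi.single_smul, smul_eq_mul, mul_one]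
    exact norm_zsmul_le (a i) (Pi.single i 1 : ι → ℤ)
  calc p a = p (∑ i, Pi.single i (a i)) := by rw [Finset.univ_sum_single]
    _ ≤ ∑ i, p (Pi.single i (a i)) :=
      Finset.le_sum_of_subadditive p (map_zero p).le (map_add_le_add p) _ _
    _ ≤ ∑ i, |(a i : ℝ)| * p (Pi.single i 1) := Finset.sum_le_sum fun i _ => hsingle i

theorem exists_addGroupSeminorm_apply_le {ι : Type*} [Fintype ι] (p : AddGroupSeminorm (ι → ℤ)) :
    ∃ L, 0 ≤ L ∧ ∀ a, p a ≤ L * ∑ i, |(a i : ℝ)| := by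
  classical
  refine ⟨∑ i, p (Pi.single i 1), Finset.sum_nonneg fun i _ => apply_nonneg p _, fun a => ?_⟩
  rw [Finset.mul_sum]
  refine (addGroupSeminorm_apply_le_sum p a).trans (Finset.sum_le_sum fun i _ => ?_)
  rw [mul_comm]
  gcongr
  exact Finset.single_le_sum (f := fun i => p (Pi.single i 1)) (fun _ _ => apply_nonneg p _)
    (Finset.mem_univ i)

variable {A G X : Type*} [AddCommGroup A] [Group G] [MetricSpace X] [MulAction G X]
  [IsIsometricSMul G X]

/-- The displacement of `o` under the elements of an abelian group acting through `φ`, as a seminorm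
on that group. -/
noncomputable def orbitSeminorm (φ : Multiplicative A →* G) (o : X) : AddGroupSeminorm A where
  toFun a := dist o (φ (.ofAdd a) • o)
  map_zero' := by simp
  add_le' a b := by
    refine (dist_triangle _ (φ (.ofAdd a) • o) _).trans_eq ?_
    rw [ofAdd_add, map_mul, mul_smul, dist_smul]
  neg' a := by rw [ofAdd_neg, map_inv, ← dist_smul (φ (.ofAdd a)), smul_inv_smul, dist_comm]

theorem orbitSeminorm_apply (φ : Multiplicative A →* G) (o : X) (a : A) :
    orbitSeminorm φ o a = dist o (φ (.ofAdd a) • o) := rfl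

theorem dist_orbit (φ : Multiplicative A →* G) (o : X) (a b : A) :
    dist (φ (.ofAdd a) • o) (φ (.ofAdd b) • o) = orbitSeminorm φ o (b - a) := by
  rw [orbitSeminorm_apply, ← dist_smul (φ (.ofAdd a)) o, smul_smul, ← map_mul, ← ofAdd_add,
    add_sub_cancel]

end Orbit

namespace GeodesicBicombing

/-! ### Geodesics between orbit points -/

section Chord

variable {G X : Type*} [Group G] [MetricSpace X] [MulAction G X] {σ : GeodesicBicombing X}

theorem IsEquivariant.smul_geod (h : σ.IsEquivariant G) (g : G) (x y : X) (t : ℝ) :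
    g • σ.geod x y t = σ.geod (g • x) (g • y) t :=
  h g x y _

theorem IsConical.geod_mem_displacementSublevel (hc : σ.IsConical) (hequiv : σ.IsEquivariant G)
    {S : Set G} {R : ℝ} {x y : X} (hx : x ∈ displacementSublevel X S R)
    (hy : y ∈ displacementSublevel X S R) {t : ℝ} (ht : t ∈ Set.Icc (0 : ℝ) 1) :
    σ.geod x y t ∈ displacementSublevel X S R := by
  intro s hs
  calc dist (σ.geod x y t) (s • σ.geod x y t)
      ≤ (1 - t) * dist x (s • x) + t * dist y (s • y) := by
        rw [hequiv.smul_geod]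
        exact hc.dist_geod_le _ _ _ _ ht
    _ ≤ (1 - t) * R + t * R := add_le_add
        (mul_le_mul_of_nonneg_left (hx s hs) (sub_nonneg.2 ht.2))
        (mul_le_mul_of_nonneg_left (hy s hs) ht.1)
    _ = R := by ring

/-- The point at time `t` on the `σ`-geodesic from `x` to `g x`, moved back by `h⁻¹`. If `h o` is
close to `σ.geod o (g o) t`, then `o` is almost fixed. -/
noncomputable def chordMap (σ : GeodesicBicombing X) (g h : G) (t : ℝ) (x : X) : X :=
  h⁻¹ • σ.geod x (g • x) t

theorem IsEquivariant.smul_chordMap (hequiv : σ.IsEquivariant G) {c g h : G} (hcg : Commute c g)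
    (hch : Commute c h) (t : ℝ) (x : X) :
    c • σ.chordMap g h t x = σ.chordMap g h t (c • x) := by
  rw [chordMap, chordMap, smul_smul, hch.inv_right.eq, mul_smul, hequiv.smul_geod, smul_smul,
    smul_smul, hcg.eq]

variable [IsIsometricSMul G X]

theorem dist_chordMap (σ : GeodesicBicombing X) (g h : G) (t : ℝ) (x : X) :
    dist (σ.chordMap g h t x) x = dist (σ.geod x (g • x) t) (h • x) := by
  rw [chordMap, ← dist_smul h, smul_inv_smul]

theorem IsConical.dist_chordMap_le (hc : σ.IsConical) (g h : G) {t : ℝ}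
    (ht : t ∈ Set.Icc (0 : ℝ) 1) (x y : X) :
    dist (σ.chordMap g h t x) (σ.chordMap g h t y) ≤ dist x y := by
  rw [chordMap, chordMap, dist_smul]
  refine (hc.dist_geod_le _ _ _ _ ht).trans_eq ?_
  rw [dist_smul]
  ring

theorem IsConical.dist_chordMap_self_le (hc : σ.IsConical) (hequiv : σ.IsEquivariant G)
    {c g h : G} (hcg : Commute c g) (hch : Commute c h) {t : ℝ} (ht : t ∈ Set.Icc (0 : ℝ) 1)
    (o x : X) :
    dist (σ.chordMap g h t o) o ≤ dist x (σ.chordMap g h t x) + 2 * dist x (c • o) := by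
  calc dist (σ.chordMap g h t o) o = dist (c • o) (σ.chordMap g h t (c • o)) := by
        rw [← hequiv.smul_chordMap hcg hch, dist_smul, dist_comm]
    _ ≤ dist (c • o) x + dist x (σ.chordMap g h t x) +
          dist (σ.chordMap g h t x) (σ.chordMap g h t (c • o)) := dist_triangle4 _ _ _ _
    _ ≤ dist x (σ.chordMap g h t x) + 2 * dist x (c • o) := by
        linarith [hc.dist_chordMap_le g h ht x (c • o), dist_comm (c • o) x]

theorem IsConical.dist_smul_chordMap_le (hc : σ.IsConical) (g h w : G) {t : ℝ}
    (ht : t ∈ Set.Icc (0 : ℝ) 1) (o x : X) :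
    dist (w • o) (σ.chordMap g h t x) ≤
      (1 - t) * dist ((h * w) • o) x + t * dist ((g⁻¹ * h * w) • o) x := by
  have hshift : dist ((g⁻¹ * h * w) • o) x = dist ((h * w) • o) (g • x) := by
    rw [← dist_smul g, smul_smul, mul_assoc, mul_inv_cancel_left]
  rw [hshift, chordMap, ← dist_smul h, smul_inv_smul, smul_smul]
  exact hc.dist_point_geod_le _ _ _ ht

theorem IsConical.mapsTo_chordMap_displacementSublevel (hc : σ.IsConical)
    (hequiv : σ.IsEquivariant G) {g h : G} {S : Set G} (hg : g ∈ Subgroup.centralizer S)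
    (hh : h ∈ Subgroup.centralizer S) (R : ℝ) {t : ℝ} (ht : t ∈ Set.Icc (0 : ℝ) 1) :
    Set.MapsTo (σ.chordMap g h t) (displacementSublevel X S R) (displacementSublevel X S R) := by
  intro x hx s hs
  rw [hequiv.smul_chordMap (Subgroup.mem_centralizer_iff.1 hg s hs)
    (Subgroup.mem_centralizer_iff.1 hh s hs)]
  exact (hc.dist_chordMap_le g h ht _ _).trans (hx s hs)

end Chord

section Resolvent

variable {X : Type*} [MetricSpace X] {σ : GeodesicBicombing X}

theorem IsConical.exists_geod_eq_self [CompleteSpace X] (hc : σ.IsConical) {o : X} {Y : Set X}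
    (hY : IsClosed Y) (ho : o ∈ Y)
    (hstar : ∀ y ∈ Y, ∀ t ∈ Set.Icc (0 : ℝ) 1, σ.geod o y t ∈ Y) {E : X → X}
    (hE : Set.MapsTo E Y Y) (hdist : ∀ x y, dist (E x) (E y) ≤ dist x y) {r : ℝ≥0} (hr : r < 1) :
    ∃ x ∈ Y, σ.geod o (E x) r = x := by
  have hmem : (r : ℝ) ∈ Set.Icc (0 : ℝ) 1 := ⟨r.coe_nonneg, mod_cast hr.le⟩
  have hmaps : Set.MapsTo (fun x => σ.geod o (E x) r) Y Y := fun x hx => hstar _ (hE hx) _ hmem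
  have hlip : LipschitzWith r fun x => σ.geod o (E x) r := LipschitzWith.of_dist_le_mul fun x y =>
    (hc.dist_geod_le_of_left _ _ _ hmem).trans (mul_le_mul_of_nonneg_left (hdist x y) hmem.1)
  obtain ⟨x, hx, hfix, -⟩ := ContractingWith.exists_fixedPoint' hY.isComplete hmaps
    ⟨hr, hlip.lipschitzOnWith.mapsToRestrict hmaps⟩ ho (edist_ne_top _ _)
  exact ⟨x, hx, hfix⟩

theorem dist_le_of_geod_eq_self {o x y : X} {ε : ℝ} (hε : 0 ≤ ε) (hε2 : ε ≤ 1 / 2)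
    (hx : σ.geod o y (1 - ε) = x) : dist x y ≤ 2 * (ε * dist o x) := by
  have hmem : 1 - ε ∈ Set.Icc (0 : ℝ) 1 := ⟨by linarith, by linarith⟩
  rw [← hx, σ.dist_geod_right _ _ hmem, σ.dist_geod_left _ _ hmem]
  nlinarith [mul_nonneg hε (dist_nonneg (x := o) (y := y))]

end Resolvent

section FlatEstimate

variable {G X : Type*} [Group G] [MetricSpace X] [MulAction G X] [IsIsometricSMul G X]
  {σ : GeodesicBicombing X} {ι : Type*} [Fintype ι]

theorem IsConical.mul_dist_le_of_geod_chordMap_eq_self (hc : σ.IsConical)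
    (φ : Multiplicative (ι → ℤ) →* G) {o x : X} {L : ℝ} (hL0 : 0 ≤ L)
    (hL : ∀ w, orbitSeminorm φ o w ≤ L * ∑ i, |(w i : ℝ)|) {a b : ι → ℤ} {B ε t : ℝ}
    (hε : 0 < ε) (hε1 : ε < 1) (ht : t ∈ Set.Icc (0 : ℝ) 1) (hab : ∀ i, |t * a i - b i| ≤ B)
    (hx : σ.geod o (σ.chordMap (φ (.ofAdd a)) (φ (.ofAdd b)) t x) (1 - ε) = x) :
    ε * dist o x ≤ L * ∑ i, (1 / 4 + 4 * B ^ 2 + 2 * ε * (a i : ℝ) ^ 2) := by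
  set u : (ι → ℤ) → ℝ := fun w => dist (φ (.ofAdd w) • o) x
  have hgrowth (w : ι → ℤ) : u w ≤ L * ∑ i, |(w i : ℝ)| + dist o x := by
    refine (dist_triangle _ o _).trans (add_le_add_left ?_ _)
    rw [dist_comm]
    exact hL w
  have hstep (w : ι → ℤ) : u w ≤ ε * (L * ∑ i, |(w i : ℝ)|) +
      (1 - ε) * ((1 - t) * u (w + b) + t * u (w + b - a)) := by
    have hb : φ (.ofAdd b) * φ (.ofAdd w) = φ (.ofAdd (w + b)) := by
      rw [← map_mul, ← ofAdd_add, add_comm]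
    have hba : (φ (.ofAdd a))⁻¹ * φ (.ofAdd b) * φ (.ofAdd w) = φ (.ofAdd (w + b - a)) := by
      rw [mul_assoc, hb, ← map_inv, ← map_mul, ← ofAdd_neg, ← ofAdd_add, neg_add_eq_sub]
    have hgeod := hc.dist_point_geod_le (φ (.ofAdd w) • o) o
      (σ.chordMap (φ (.ofAdd a)) (φ (.ofAdd b)) t x) (t := 1 - ε) ⟨by linarith, by linarith⟩
    rw [hx, sub_sub_cancel, dist_comm _ o] at hgeod
    have hchord := hc.dist_smul_chordMap_le (φ (.ofAdd a)) (φ (.ofAdd b)) (φ (.ofAdd w)) ht o x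
    rw [hb, hba] at hchord
    exact hgeod.trans (add_le_add (mul_le_mul_of_nonneg_left (hL w) hε.le)
      (mul_le_mul_of_nonneg_left hchord (sub_nonneg.2 hε1.le)))
  simpa [u] using mul_apply_zero_le_of_le_discounted_average hL0 hε hε1 ht hab hgrowth hstep

theorem IsConical.dist_geod_orbit_le_add [CompleteSpace X] (hc : σ.IsConical)
    (hequiv : σ.IsEquivariant G) (φ : Multiplicative (ι → ℤ) →* G) {S : Set G}
    (hS : Subgroup.closure S = φ.range) {o : X} {R D L : ℝ} (ho : o ∈ displacementSublevel X S R)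
    (hD : ∀ x ∈ displacementSublevel X S R, ∃ c ∈ Subgroup.centralizer S, dist x (c • o) ≤ D)
    (hL0 : 0 ≤ L) (hL : ∀ w, orbitSeminorm φ o w ≤ L * ∑ i, |(w i : ℝ)|) {a b : ι → ℤ}
    {B ε t : ℝ} (hε : 0 < ε) (hε2 : ε ≤ 1 / 2) (ht : t ∈ Set.Icc (0 : ℝ) 1)
    (hab : ∀ i, |t * a i - b i| ≤ B) :
    dist (σ.geod o (φ (.ofAdd a) • o) t) (φ (.ofAdd b) • o) ≤
      2 * (L * ∑ i, (1 / 4 + 4 * B ^ 2 + 2 * ε * (a i : ℝ) ^ 2)) + 2 * D := by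
  have hφ (w : ι → ℤ) : φ (.ofAdd w) ∈ Subgroup.centralizer S := by
    rw [← Subgroup.centralizer_closure, hS, Subgroup.mem_centralizer_iff]
    rintro _ ⟨v, rfl⟩
    rw [← map_mul, mul_comm, map_mul]
  have hcomm {c : G} (hcS : c ∈ Subgroup.centralizer S) (w : ι → ℤ) :
      Commute c (φ (.ofAdd w)) := by
    rw [← Subgroup.centralizer_closure, hS] at hcS
    exact (Subgroup.mem_centralizer_iff.1 hcS _ ⟨_, rfl⟩).symm
  have hr : ((1 - ε).toNNReal : ℝ) = 1 - ε := Real.coe_toNNReal _ (by linarith)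
  obtain ⟨x, hxS, hx⟩ := hc.exists_geod_eq_self (r := (1 - ε).toNNReal)
    (isClosed_displacementSublevel S R) ho
    (fun y hy s hs => hc.geod_mem_displacementSublevel hequiv ho hy hs)
    (hc.mapsTo_chordMap_displacementSublevel hequiv (hφ a) (hφ b) R ht)
    (hc.dist_chordMap_le _ _ ht) (Real.toNNReal_lt_one.2 (by linarith))
  rw [hr] at hx
  obtain ⟨c, hcS, hcx⟩ := hD x hxS
  have hmove := dist_le_of_geod_eq_self hε.le hε2 hx
  have hdisc := hc.mul_dist_le_of_geod_chordMap_eq_self φ hL0 hL hε (by linarith) ht hab hx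
  have hself := hc.dist_chordMap_self_le hequiv (hcomm hcS a) (hcomm hcS b) ht o x
  rw [dist_chordMap] at hself
  linarith

end FlatEstimate

theorem IsConical.exists_dist_geod_orbit_le {G X : Type*} [Group G] [MetricSpace X]
    [MulAction G X] {σ : GeodesicBicombing X} {ι : Type*} [Finite ι] [ProperSpace X]
    (hc : σ.IsConical) (hequiv : σ.IsEquivariant G) (hG : IsGeometricAction G X)
    (φ : Multiplicative (ι → ℤ) →* G) (o : X) (B : ℝ) :
    ∃ C, ∀ a b : ι → ℤ, ∀ t ∈ Set.Icc (0 : ℝ) 1, (∀ i, |t * a i - b i| ≤ B) →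
      dist (σ.geod o (φ (.ofAdd a) • o) t) (φ (.ofAdd b) • o) ≤ C := by
  have := Fintype.ofFinite ι
  have := hG.isIsometricSMul
  obtain ⟨S, hS, hSfin⟩ :=
    (Subgroup.fg_iff _).1 ((Group.fg_iff_subgroup_fg _).1 (Group.fg_range φ))
  obtain ⟨R, hR⟩ := (hSfin.image fun s => dist o (s • o)).bddAbove
  have ho : o ∈ displacementSublevel X S R := fun s hs => hR ⟨s, hs, rfl⟩
  obtain ⟨D, hD⟩ := hG.exists_mem_centralizer_dist_le o hSfin R
  obtain ⟨L, hL0, hL⟩ := exists_addGroupSeminorm_apply_le (orbitSeminorm φ o)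
  refine ⟨2 * (L * ∑ _ : ι, (1 / 4 + 4 * B ^ 2)) + 2 * D, fun a b t ht hab => ?_⟩
  refine le_of_forall_le_add_div (c := 2 * (L * ∑ i, (a i : ℝ) ^ 2)) fun T hT => ?_
  have hT0 : 0 < T := zero_lt_one.trans_le hT
  have hε2 : 1 / (2 * T) ≤ 1 / 2 := one_div_le_one_div_of_le two_pos (by linarith)
  have hε : 0 < 1 / (2 * T) := one_div_pos.2 (mul_pos two_pos hT0)
  refine (hc.dist_geod_orbit_le_add hequiv φ hS ho hD hL0 hL hε hε2 ht hab).trans_eq ?_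
  rw [Finset.sum_add_distrib, ← Finset.mul_sum]
  field_simp
  ring

end GeodesicBicombing

/-! ### The orbit of a free abelian group as a coarse cone -/

section FloorOrbit

variable {G X : Type*} [Group G] [MulAction G X] {ι : Type*}

/-- The orbit of `o` under `ℤ^ι`, extended to `ℝ^ι` by rounding coordinates down. -/
noncomputable def floorOrbit (φ : Multiplicative (ι → ℤ) →* G) (o : X) (v : EuclideanSpace ℝ ι) :
    X :=
  φ (.ofAdd fun i => ⌊v i⌋) • o

theorem floorOrbit_intCast (φ : Multiplicative (ι → ℤ) →* G) (o : X) (a : ι → ℤ) :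
    floorOrbit φ o (WithLp.toLp 2 fun i => (a i : ℝ)) = φ (.ofAdd a) • o := by
  simp only [floorOrbit, Int.floor_intCast]

variable [MetricSpace X]

theorem dist_floorOrbit [IsIsometricSMul G X] (φ : Multiplicative (ι → ℤ) →* G) (o : X)
    (v w : EuclideanSpace ℝ ι) :
    dist (floorOrbit φ o v) (floorOrbit φ o w) = orbitSeminorm φ o fun i => ⌊w i⌋ - ⌊v i⌋ :=
  dist_orbit φ o _ _

theorem abs_sub_sub_floor_sub_floor_le (x y : ℝ) :
    |(x - y) - ((⌊x⌋ - ⌊y⌋ : ℤ) : ℝ)| ≤ 1 := by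
  have hfract : (x - y) - ((⌊x⌋ - ⌊y⌋ : ℤ) : ℝ) = Int.fract x - Int.fract y := by
    rw [Int.fract, Int.fract]
    push_cast
    ring
  rw [hfract, abs_sub_le_iff]
  constructor <;> linarith [Int.fract_nonneg x, Int.fract_nonneg y, Int.fract_lt_one x,
    Int.fract_lt_one y]

theorem abs_mul_floor_sub_floor_mul_le {t : ℝ} (ht : t ∈ Set.Icc (0 : ℝ) 1) (x : ℝ) :
    |t * ⌊x⌋ - ⌊t * x⌋| ≤ 1 := by
  have hle := mul_le_mul_of_nonneg_left (Int.floor_le x) ht.1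
  have hlt := mul_le_mul_of_nonneg_left (Int.lt_floor_add_one x).le ht.1
  rw [abs_sub_le_iff]
  constructor <;> linarith [ht.2, Int.floor_le (t * x), Int.lt_floor_add_one (t * x)]

variable [Fintype ι]

theorem exists_dist_floorOrbit_le [IsIsometricSMul G X] (φ : Multiplicative (ι → ℤ) →* G)
    (o : X) : ∃ K : ℝ, ∀ v w, dist (floorOrbit φ o v) (floorOrbit φ o w) ≤ K * (dist v w + 1) := by
  obtain ⟨L, hL0, hL⟩ := exists_addGroupSeminorm_apply_le (orbitSeminorm φ o)
  refine ⟨L * Fintype.card ι, fun v w => ?_⟩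
  have hcoord (i : ι) : |((⌊w i⌋ - ⌊v i⌋ : ℤ) : ℝ)| ≤ dist v w + 1 := by
    have hfloor := (abs_sub_abs_le_abs_sub _ _).trans
      ((abs_sub_comm _ _).trans_le (abs_sub_sub_floor_sub_floor_le (w i) (v i)))
    have hdist : |w i - v i| ≤ dist v w := by
      rw [dist_comm, dist_eq_norm]
      exact PiLp.norm_apply_le (w - v) i
    linarith
  calc dist (floorOrbit φ o v) (floorOrbit φ o w)
      ≤ L * ∑ i, |((⌊w i⌋ - ⌊v i⌋ : ℤ) : ℝ)| := (dist_floorOrbit φ o v w).trans_le (hL _)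
    _ ≤ L * ∑ _ : ι, (dist v w + 1) :=
      mul_le_mul_of_nonneg_left (Finset.sum_le_sum fun i _ => hcoord i) hL0
    _ = L * Fintype.card ι * (dist v w + 1) := by
      rw [Finset.sum_const, Finset.card_univ, nsmul_eq_mul, mul_assoc]

theorem IsGeometricAction.isUniformlyProper_floorOrbit [ProperSpace X]
    (hG : IsGeometricAction G X) {φ : Multiplicative (ι → ℤ) →* G} (hφ : Function.Injective φ)
    (o : X) : IsUniformlyProper (floorOrbit φ o) := by
  intro r
  have := hG.isIsometricSMul
  have hfin : {a : ι → ℤ | orbitSeminorm φ o a ≤ r}.Finite :=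
    (hG.finite_setOf_dist_le o r).preimage (hφ.comp Multiplicative.ofAdd.injective).injOn
  obtain ⟨M, hM⟩ := (hfin.image norm).bddAbove
  obtain ⟨K, hK⟩ : ∃ K : ℝ≥0, AntilipschitzWith K (WithLp.ofLp : EuclideanSpace ℝ ι → ι → ℝ) :=
    ⟨_, PiLp.antilipschitzWith_ofLp 2 _⟩
  refine ⟨K * (M + 1), fun v w hvw => (hK.le_mul_dist v w).trans ?_⟩
  rw [dist_floorOrbit] at hvw
  have hM0 : 0 ≤ M := (norm_nonneg _).trans (hM ⟨_, hvw, rfl⟩)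
  refine mul_le_mul_of_nonneg_left ((dist_pi_le_iff (by positivity)).2 fun i => ?_) K.coe_nonneg
  have hint : |((⌊w i⌋ - ⌊v i⌋ : ℤ) : ℝ)| ≤ M := by
    rw [← Int.norm_eq_abs]
    exact (norm_le_pi_norm (fun i => ⌊w i⌋ - ⌊v i⌋) i).trans (hM ⟨_, hvw, rfl⟩)
  have hfloor := (abs_sub_abs_le_abs_sub _ _).trans (abs_sub_sub_floor_sub_floor_le (w i) (v i))
  rw [dist_comm, Real.dist_eq]
  linarith

theorem IsGeometricAction.isCoarseCone_floorOrbit [ProperSpace X] (hG : IsGeometricAction G X)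
    {σ : GeodesicBicombing X} (hc : σ.IsConical) (hequiv : σ.IsEquivariant G)
    {φ : Multiplicative (ι → ℤ) →* G} (hφ : Function.Injective φ) (o : X) :
    σ.IsCoarseCone o (floorOrbit φ o) where
  dist_geod_le := by
    obtain ⟨C, hC⟩ := hc.exists_dist_geod_orbit_le hequiv hG φ o 1
    exact ⟨C, fun v t ht => hC _ _ t ht fun i => abs_mul_floor_sub_floor_mul_le ht (v i)⟩
  dist_le := by
    have := hG.isIsometricSMul
    exact exists_dist_floorOrbit_le φ o
  isUniformlyProper := hG.isUniformlyProper_floorOrbit hφ o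

end FloorOrbit

theorem propositionp_general {G : Type*} [Group G] {X : Type*} [MetricSpace X] [ProperSpace X]
    [MulAction G X] (hG : IsGeometricAction G X)
    (σ : GeodesicBicombing X) (hccc : σ.IsCCC) (hequiv : σ.IsEquivariant G)
    {ι : Type*} [Fintype ι] (A : Subgroup G) (hA : Nonempty (A ≃* Multiplicative (ι → ℤ))) (o : X) :
    (∃ f : Metric.sphere (0 : EuclideanSpace ℝ ι) 1 → σ.Boundary o, Topology.IsEmbedding f) ∧
    (A.FiniteIndex → Nonempty (σ.Boundary o ≃ₜ Metric.sphere (0 : EuclideanSpace ℝ ι) 1)) := by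
  obtain ⟨e⟩ := hA
  let φ : Multiplicative (ι → ℤ) →* G := A.subtype.comp e.symm.toMonoidHom
  have hφ : Function.Injective φ := A.subtype_injective.comp e.symm.injective
  obtain ⟨R, hR, C, hC⟩ :=
    (hG.isCoarseCone_floorOrbit hccc.conical hequiv hφ o).exists_isCone hccc
  have hemb := hR.isEmbedding_sphereMap hccc.conical
  refine ⟨⟨_, hemb⟩, fun hfin => ?_⟩
  obtain ⟨D, hD⟩ := hG.exists_dist_smul_le_of_finiteIndex A o
  have hdense (x : X) : ∃ v, dist (R v) x ≤ C + D := by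
    obtain ⟨a, ha, hx⟩ := hD x
    obtain ⟨b, hb⟩ : ∃ b, φ (.ofAdd b) = a := ⟨(e ⟨a, ha⟩).toAdd, by simp [φ]⟩
    have hRb := hC (WithLp.toLp 2 fun i => (b i : ℝ))
    rw [floorOrbit_intCast, hb] at hRb
    exact ⟨_, (dist_triangle_left _ _ (a • o)).trans
      (add_le_add hRb ((dist_comm _ _).trans_le hx))⟩
  exact ⟨(hemb.toHomeomorphOfSurjective (hR.surjective_sphereMap hccc.conical hdense)).symm⟩

theorem propositionp {G : Type*} [Group G] {X : Type*} [MetricSpace X] [ProperSpace X]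
    [MulAction G X] (hG : IsGeometricAction G X)
    (σ : GeodesicBicombing X) (hccc : σ.IsCCC) (hrev : σ.IsReversible)
    (hequiv : σ.IsEquivariant G)
    (n : ℕ) (A : Subgroup G) (hA : Nonempty (A ≃* Multiplicative (Fin n → ℤ))) (o : X) :
    (∃ f : Metric.sphere (0 : EuclideanSpace ℝ (Fin n)) 1 → σ.Boundary o,
      Topology.IsEmbedding f) ∧
    (A.FiniteIndex →
      Nonempty (σ.Boundary o ≃ₜ Metric.sphere (0 : EuclideanSpace ℝ (Fin n)) 1)) :=
  propositionp_general hG σ hccc hequiv A hA o
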